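/- Let $N$ be a finite set of players. A welfare function is a map $W:2^N\to\mathbb{R}$. A distribution rule is a map $f:N\times 2^N\to\mathbb{R}$ with $f(i,S)=0$ whenever $i\notin S$; no budget-balance is required. Let $\mathbb{W}$ be any set of welfare functions, and for each $W\in\mathbb{W}$ let $f^W$ be a distribution rule. A game in the class $\mathcal{G}(N,f^{\mathbb{W}},\mathbb{W})$ consists of a finite set $R$ of at least two resources, a local welfare function $W_r\in\mathbb{W}$ for each $r\in R$, and a nonempty action set $\mathcal{A}_i\subseteq 2^R$ for each $i\in N$. In the action profile $a=(a_i)_{i\in N}\in\prod_{i\in N}\mathcal{A}_i$ player $i$ has utility $$U_i(a)=\sum_{r\in a_i}f^{W_r}\bigl(i,\{j\in N: r\in a_j\}\bigr),$$ and $a$ is a pure Nash equilibrium if $U_i(b,a_{-i})\le U_i(a)$ for all $i\in N$ and $b\in\mathcal{A}_i$. A weight system $\omega=(\lambda,\Sigma)$ consists of weights $\lambda_i>0$ ($i\in N$) and an ordered partition $\Sigma=(S_1,\dots,S_m)$ of $N$. For nonempty $T\subseteq N$ let $\overline{T}=T\cap S_k$, where $k=\min\{j: S_j\cap T\neq\emptyset\}$.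 The generalized weighted Shapley value rule of a welfare function $W$ is $$f^{W}_{GWSV}[\omega](i,S)=\sum_{T\subseteq S:\ i\in\overline{T}}\frac{\lambda_i}{\sum_{j\in\overline{T}}\lambda_j}\sum_{Q\subseteq T}(-1)^{|T|-|Q|}W(Q).$$ Theorem. Every game in $\mathcal{G}(N,f^{\mathbb{W}},\mathbb{W})$ has a pure Nash equilibrium if and only if there is a single weight system $\omega$ such that for every $W\in\mathbb{W}$ $$f^W=f^{W'}_{GWSV}[\omega],\qquad\text{where } W'(S)=\sum_{i\in S}f^W(i,S)\text{ for all }S\subseteq N.$$ -/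

import Mathlib

namespace WelfareSharing

/-- A (local) welfare function: a real number for every set of players. -/
abbrev Welfare (N : Type*) : Type _ := Finset N → ℝ

/-- A (local) distribution rule: `f i S` is the share of player `i` when the players of `S` share
the welfare. Players outside `S` get nothing. The shares need not add up to any given welfare. -/
@[ext]
structure DistributionRule (N : Type*) where
  share : N → Finset N → ℝ
  share_eq_zero : ∀ i S, i ∉ S → share i S = 0

instance {N : Type*} : CoeFun (DistributionRule N) (fun _ => N → Finset N → ℝ) :=
  ⟨DistributionRule.share⟩

/-- The welfare that a distribution rule actually distributes. -/
def DistributionRule.groundWelfare {N : Type*} (f : DistributionRule N) : Welfare N :=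
  fun S => ∑ i ∈ S, f i S

/-- A welfare sharing game with player set `N`: a finite set of at least two resources, nonempty
sets of actions (an action is a set of resources), a local welfare function and a local distribution
rule at every resource, where equal local welfare functions come with equal distribution rules. -/
structure WelfareGame (N : Type*) where
  Resource : Type
  [fintypeResource : Fintype Resource]
  [decidableEqResource : DecidableEq Resource]
  one_lt_card : 1 < Fintype.card Resource
  actions : N → Set (Finset Resource)
  actions_nonempty : ∀ i, (actions i).Nonempty
  welfare : Resource → Welfare N
  rule : Resource → DistributionRule N
  rule_eq_of_welfare_eq : ∀ r r', welfare r = welfare r' → rule r = rule r'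

attribute [instance] WelfareGame.fintypeResource WelfareGame.decidableEqResource

namespace WelfareGame

variable {N : Type*} [Fintype N] (G : WelfareGame N)

/-- The set of players that have chosen the resource `r` in the action profile `a`. -/
def users (a : N → Finset G.Resource) (r : G.Resource) : Finset N :=
  Finset.univ.filter fun i => r ∈ a i

/-- The utility of player `i` in the action profile `a`. -/
def utility (i : N) (a : N → Finset G.Resource) : ℝ :=
  ∑ r ∈ a i, G.rule r i (G.users a r)

/-- `a` is a pure Nash equilibrium: an admissible action profile in which no player can increase
its utility by a unilateral change of its action. -/
def IsNashEquilibrium [DecidableEq N] (a : N → Finset G.Resource) : Prop :=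
  (∀ i, a i ∈ G.actions i) ∧
    ∀ i, ∀ b ∈ G.actions i, G.utility i (Function.update a i b) ≤ G.utility i a

end WelfareGame

/-- The class of all welfare sharing games with player set `N`, all of whose local welfare functions
`W` are in `𝕎`, with the distribution rule `f W` at every resource that has the welfare `W`. -/
def gameClass {N : Type*} (𝕎 : Set (Welfare N)) (f : 𝕎 → DistributionRule N) :
    Set (WelfareGame N) :=
  {G | ∀ r, ∃ h : G.welfare r ∈ 𝕎, G.rule r = f ⟨G.welfare r, h⟩}

/-- A weight system on `N`: positive weights and an ordered partition of `N`. -/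
structure WeightSystem (N : Type*) where
  weight : N → ℝ
  weight_pos : ∀ i, 0 < weight i
  numParts : ℕ
  part : Fin numParts → Finset N
  part_nonempty : ∀ k, (part k).Nonempty
  part_disjoint : ∀ k l, k ≠ l → Disjoint (part k) (part l)
  part_cover : ∀ i, ∃ k, i ∈ part k

open Classical in
/-- The members of `T` of highest priority: `T ∩ S_k` for the least `k` such that the part `S_k`
meets `T`. -/
noncomputable def WeightSystem.leaders {N : Type*} (ω : WeightSystem N) (T : Finset N) : Finset N :=
  T.filter fun i => ∃ k, IsLeast {j | (ω.part j ∩ T).Nonempty} k ∧ i ∈ ω.part k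

open Classical in
/-- The share of player `i` in `S` under the generalized weighted Shapley value of `W` with weight
system `ω`. -/
noncomputable def gwsvShare {N : Type*} (ω : WeightSystem N) (W : Welfare N) (i : N)
    (S : Finset N) : ℝ :=
  ∑ T ∈ S.powerset.filter (fun T => i ∈ ω.leaders T),
    ω.weight i / (∑ j ∈ ω.leaders T, ω.weight j) *
      ∑ R ∈ T.powerset, (-1 : ℝ) ^ (T.card - R.card) * W R

/-- The generalized weighted Shapley value distribution rule of `W` with weight system `ω`. -/
noncomputable def gwsv {N : Type*} (ω : WeightSystem N) (W : Welfare N) : DistributionRule N where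
  share := gwsvShare ω W
  share_eq_zero := by
    classical
    intro i S hi
    unfold gwsvShare
    rw [Finset.filter_false_of_mem, Finset.sum_empty]
    intro T hT h
    exact hi (Finset.mem_powerset.1 hT (Finset.mem_filter.1 h).1)

end WelfareSharing

/-!
If every player chooses one of two resources according to a sign `x k = ±1`, then up to an additive
constant the players `i` and `j` receive `c i j * x i * x j` and `c j i * x i * x j` from each
other, where `c i j` measures how the presence of `j` changes the share of `i`. Copies of such
gadgets add up the matrices `c`, and exchanging the two resources for one of the players negates
them, so the existence of equilibria makes every real combination `c` of them stable: there are
signs `x` with `0 ≤ ∑ l, c k l * x k * x l` for all `k`. The matrices that contain only the Möbius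
coefficients of the shares of two players in one coalition are such combinations.

If the interactions along a cycle of players dominated those in the opposite direction, stability
would force the signs of these interactions, which are arbitrary, to multiply to `1`. Hence the
product of the ratios of the interactions around a cycle is at least `1`, and it is `1` if the cycle
can be reversed. So the nonzero ratios are quotients of weights, and the vanishing ones order the
players into parts. A rule whose Möbius coefficients are distributed according to weights and parts
is a generalized weighted Shapley value.

Conversely, under such rules an improving deviation of a player of rank `k` increases a weighted
potential of the players of rank `k` and leaves the potentials of all higher ranks unchanged, so the
vector of all these potentials, compared lexicographically, is an ordinal potential.
-/

namespace WelfareSharing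

/-! ### Möbius transforms of set functions -/

section Moebius

variable {α R : Type*} [Ring R]

/-- The Möbius transform of a set function `W`: its value at `T` is the coefficient (Harsanyi
dividend) of the unanimity game of `T` in `W`. -/
def moebius (W : Finset α → R) (T : Finset α) : R :=
  ∑ Q ∈ T.powerset, (-1 : R) ^ (T.card - Q.card) * W Q

theorem moebius_eq_zero {W : Finset α → R} {T : Finset α} (h : ∀ Q ⊆ T, W Q = 0) :
    moebius W T = 0 :=
  Finset.sum_eq_zero fun Q hQ => by rw [h Q (Finset.mem_powerset.1 hQ), mul_zero]

theorem moebius_sub (W V : Finset α → R) (T : Finset α) :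
    moebius (fun Q => W Q - V Q) T = moebius W T - moebius V T := by
  simp only [moebius, mul_sub, Finset.sum_sub_distrib]

theorem moebius_insert [DecidableEq α] (W : Finset α → R) {a : α} {T : Finset α} (ha : a ∉ T) :
    moebius W (insert a T) = moebius (fun Q => W (insert a Q)) T - moebius W T := by
  unfold moebius
  rw [Finset.sum_powerset_insert ha, add_comm, sub_eq_add_neg, ← Finset.sum_neg_distrib]
  congr 1
  · refine Finset.sum_congr rfl fun Q hQ => ?_
    have haQ : a ∉ Q := fun h => ha (Finset.mem_powerset.1 hQ h)
    rw [Finset.card_insert_of_notMem ha, Finset.card_insert_of_notMem haQ, Nat.add_sub_add_right]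
  · refine Finset.sum_congr rfl fun Q hQ => ?_
    have hcard := Finset.card_le_card (Finset.mem_powerset.1 hQ)
    rw [Finset.card_insert_of_notMem ha, Nat.sub_add_comm hcard, pow_succ, mul_neg_one, neg_mul]

theorem sum_powerset_moebius (W : Finset α → R) (S : Finset α) :
    ∑ T ∈ S.powerset, moebius W T = W S := by
  classical
  induction S using Finset.induction_on generalizing W with
  | empty => simp [moebius]
  | insert a S ha ih =>
    rw [Finset.sum_powerset_insert ha, ← ih fun Q => W (insert a Q), ← Finset.sum_add_distrib]
    refine Finset.sum_congr rfl fun T hT => ?_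
    rw [moebius_insert W fun h => ha (Finset.mem_powerset.1 hT h), add_sub_cancel]

end Moebius

namespace DistributionRule

variable {N : Type*} (f : DistributionRule N)

theorem moebius_eq_zero_of_notMem {i : N} {T : Finset N} (hi : i ∉ T) : moebius (f i) T = 0 :=
  moebius_eq_zero fun Q hQ => f.share_eq_zero i Q fun h => hi (hQ h)

theorem moebius_groundWelfare (T : Finset N) :
    moebius f.groundWelfare T = ∑ i ∈ T, moebius (f i) T := by
  have hground : ∀ Q ∈ T.powerset, f.groundWelfare Q = ∑ i ∈ T, f i Q := fun Q hQ =>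
    Finset.sum_subset (Finset.mem_powerset.1 hQ) fun i _ hi => f.share_eq_zero i Q hi
  simp only [moebius]
  rw [Finset.sum_comm]
  exact Finset.sum_congr rfl fun Q hQ => by rw [hground Q hQ, Finset.mul_sum]

variable [DecidableEq N]

/-- The change of the share of `i` when `j` joins `i` and the players of `K`. -/
def influence (i j : N) (K : Finset N) : ℝ :=
  f i (insert i (insert j K)) - f i (insert i K)

theorem moebius_insert_insert {i j : N} {K : Finset N} (hij : i ≠ j) (hi : i ∉ K) (hj : j ∉ K) :
    moebius (f i) (insert i (insert j K)) = moebius (f.influence i j) K := by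
  have hi' : i ∉ insert j K := by simp [hij, hi]
  rw [moebius_insert _ hi', f.moebius_eq_zero_of_notMem hi', sub_zero, moebius_insert _ hj]
  exact (moebius_sub _ _ _).symm

end DistributionRule

/-! ### Ranks of weight systems -/

namespace WeightSystem

variable {N : Type*} (ω : WeightSystem N)

/-- The index of the part of `ω` that contains the player `i`; players of low rank lead. -/
noncomputable def rank (i : N) : Fin ω.numParts :=
  (ω.part_cover i).choose

theorem mem_part_iff {i : N} {k : Fin ω.numParts} : i ∈ ω.part k ↔ ω.rank i = k := by
  have hi : i ∈ ω.part (ω.rank i) := (ω.part_cover i).choose_spec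
  refine ⟨fun hk => ?_, fun h => h ▸ hi⟩
  by_contra hne
  exact Finset.disjoint_left.1 (ω.part_disjoint _ _ hne) hi hk

theorem mem_leaders_iff {i : N} {T : Finset N} :
    i ∈ ω.leaders T ↔ i ∈ T ∧ ∀ j ∈ T, ω.rank i ≤ ω.rank j := by
  classical
  simp only [leaders, Finset.mem_filter, mem_part_iff, IsLeast, lowerBounds, Finset.Nonempty,
    Finset.mem_inter, Set.mem_ofPred_eq]
  grind

/-- The weight system with the given weights whose parts are the fibres of `h`, in the order of the
values of `h`. -/
noncomputable def ofRank [Fintype N] {κ : Type*} [LinearOrder κ] (weight : N → ℝ)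
    (weight_pos : ∀ i, 0 < weight i) (h : N → κ) : WeightSystem N where
  weight := weight
  weight_pos := weight_pos
  numParts := (Finset.univ.image h).card
  part k := Finset.univ.filter fun i => h i = (Finset.univ.image h).orderEmbOfFin rfl k
  part_nonempty k := by
    obtain ⟨i, -, hi⟩ := Finset.mem_image.1 ((Finset.univ.image h).orderEmbOfFin_mem rfl k)
    exact ⟨i, by simp [hi]⟩
  part_disjoint k l hkl := by
    refine Finset.disjoint_left.2 fun i hk hl => hkl ?_
    simp only [Finset.mem_filter, Finset.mem_univ, true_and] at hk hl
    exact ((Finset.univ.image h).orderEmbOfFin rfl).injective (hk.symm.trans hl)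
  part_cover i := by
    have hi : h i ∈ Set.range ((Finset.univ.image h).orderEmbOfFin rfl) := by simp
    obtain ⟨k, hk⟩ := hi
    exact ⟨k, by simp [hk]⟩

theorem rank_ofRank_le_iff [Fintype N] {κ : Type*} [LinearOrder κ] {weight : N → ℝ}
    {weight_pos : ∀ i, 0 < weight i} {h : N → κ} {i j : N} :
    (ofRank weight weight_pos h).rank i ≤ (ofRank weight weight_pos h).rank j ↔ h i ≤ h j := by
  have hrank : ∀ i, h i = (Finset.univ.image h).orderEmbOfFin rfl
      ((ofRank weight weight_pos h).rank i) := fun i => by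
    simpa [ofRank] using (ofRank weight weight_pos h).mem_part_iff.2 (Eq.refl (rank _ i))
  rw [hrank i, hrank j]
  exact (OrderEmbedding.le_iff_le _).symm

/-- The amounts `p` and `q` of the players `i` and `j` are in accordance with `ω`: proportional to
the weights if the ranks are equal, and otherwise nothing for the player of higher rank. -/
def Respects (i j : N) (p q : ℝ) : Prop :=
  p ≠ 0 → (q = 0 → ω.rank i < ω.rank j) ∧
    (q ≠ 0 → ω.rank i = ω.rank j ∧ ω.weight j * p = ω.weight i * q)

variable {ω} {T : Finset N} {c : N → ℝ}

theorem mem_leaders_iff_ne_zero_of_respects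
    (hc : ∀ i ∈ T, ∀ j ∈ T, i ≠ j → ω.Respects i j (c i) (c j)) (hne : ∃ i ∈ T, c i ≠ 0) {i : N}
    (hi : i ∈ T) : i ∈ ω.leaders T ↔ c i ≠ 0 := by
  rw [mem_leaders_iff]
  refine ⟨fun hlead hci => ?_, fun hci => ⟨hi, fun j hj => ?_⟩⟩
  · obtain ⟨p, hp, hcp⟩ := hne
    have hlt := (hc p hp i hi (by rintro rfl; exact hcp hci) hcp).1 hci
    exact hlt.not_ge (hlead.2 p hp)
  · rcases eq_or_ne i j with rfl | hij
    · exact le_rfl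
    rcases eq_or_ne (c j) 0 with hcj | hcj
    · exact ((hc i hi j hj hij hci).1 hcj).le
    · exact ((hc i hi j hj hij hci).2 hcj).1.le

theorem eq_div_mul_sum_of_respects
    (hc : ∀ i ∈ T, ∀ j ∈ T, i ≠ j → ω.Respects i j (c i) (c j)) {i : N} (hi : i ∈ ω.leaders T) :
    c i = ω.weight i / (∑ j ∈ ω.leaders T, ω.weight j) * ∑ j ∈ T, c j := by
  by_cases hne : ∃ j ∈ T, c j ≠ 0
  · have hmem : ∀ j ∈ ω.leaders T, j ∈ T ∧ c j ≠ 0 := fun j hj =>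
      have hjT := (ω.mem_leaders_iff.1 hj).1
      ⟨hjT, (mem_leaders_iff_ne_zero_of_respects hc hne hjT).1 hj⟩
    have hsum : ∑ j ∈ T, c j = ∑ j ∈ ω.leaders T, c j :=
      (Finset.sum_subset (fun j hj => (hmem j hj).1) fun j hj hjl =>
        by_contra fun h => hjl ((mem_leaders_iff_ne_zero_of_respects hc hne hj).2 h)).symm
    have hprop : ∀ j ∈ ω.leaders T, ω.weight j * c i = ω.weight i * c j := fun j hj => by
      rcases eq_or_ne i j with rfl | hij
      · rfl
      · exact ((hc i (hmem i hi).1 j (hmem j hj).1 hij (hmem i hi).2).2 (hmem j hj).2).2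
    have hpos : 0 < ∑ j ∈ ω.leaders T, ω.weight j :=
      Finset.sum_pos (fun j _ => ω.weight_pos j) ⟨i, hi⟩
    rw [hsum, div_mul_eq_mul_div, eq_div_iff hpos.ne', mul_comm, Finset.sum_mul, Finset.mul_sum]
    exact Finset.sum_congr rfl hprop
  · push Not at hne
    rw [Finset.sum_eq_zero hne, mul_zero, hne i (ω.mem_leaders_iff.1 hi).1]

end WeightSystem

theorem eq_gwsv_groundWelfare {N : Type*} {f : DistributionRule N} {ω : WeightSystem N}
    (hf : ∀ T, ∀ i ∈ T, ∀ j ∈ T, i ≠ j → ω.Respects i j (moebius (f i) T) (moebius (f j) T)) :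
    f = gwsv ω f.groundWelfare := by
  classical
  ext i S
  change f i S = ∑ T ∈ S.powerset.filter (fun T => i ∈ ω.leaders T),
    ω.weight i / (∑ j ∈ ω.leaders T, ω.weight j) * moebius f.groundWelfare T
  rw [← sum_powerset_moebius (f i) S, Finset.sum_filter]
  refine Finset.sum_congr rfl fun T _ => ?_
  rw [f.moebius_groundWelfare]
  split_ifs with hi
  · exact WeightSystem.eq_div_mul_sum_of_respects (hf T) hi
  · by_contra hne
    have hiT : i ∈ T := not_imp_comm.1 f.moebius_eq_zero_of_notMem hne
    exact hi ((WeightSystem.mem_leaders_iff_ne_zero_of_respects (c := fun j => moebius (f j) T)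
      (hf T) ⟨i, hiT, hne⟩ hiT).2 hne)

/-! ### Potentials of generalized weighted Shapley values -/

namespace WeightSystem

variable {N : Type*} (ω : WeightSystem N) (W : Welfare N)

open Classical in
/-- The potential at a resource with welfare `W` for the players of rank `k`: the sum of the
dividends of the coalitions led by players of rank `k`, per unit of weight of their leaders. -/
noncomputable def rankPotential (k : Fin ω.numParts) (S : Finset N) : ℝ :=
  ∑ T ∈ S.powerset.filter (fun T => ∃ j ∈ ω.leaders T, ω.rank j = k),
    moebius W T / ∑ j ∈ ω.leaders T, ω.weight j

variable [DecidableEq N]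

theorem rankPotential_rank (i : N) (S : Finset N) :
    ω.rankPotential W (ω.rank i) S =
      (ω.weight i)⁻¹ * gwsv ω W i S + ω.rankPotential W (ω.rank i) (S.erase i) := by
  classical
  have hled : ∀ T, (∃ j ∈ ω.leaders T, ω.rank j = ω.rank i) → i ∈ T → i ∈ ω.leaders T := by
    rintro T ⟨j, hj, hji⟩ hi
    exact ω.mem_leaders_iff.2 ⟨hi, hji ▸ (ω.mem_leaders_iff.1 hj).2⟩
  simp only [rankPotential]
  rw [← Finset.sum_filter_add_sum_filter_not _ (fun T => i ∈ ω.leaders T), Finset.filter_filter,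
    Finset.filter_filter]
  congr 1
  · simp only [gwsv, gwsvShare]
    rw [Finset.mul_sum]
    refine Finset.sum_congr (Finset.ext fun T => ?_) fun T _ => ?_
    · simp only [Finset.mem_filter]
      exact and_congr_right fun _ => ⟨fun h => h.2, fun h => ⟨⟨i, h, rfl⟩, h⟩⟩
    · change _ = (ω.weight i)⁻¹ * (_ * moebius W T)
      have := (ω.weight_pos i).ne'
      field_simp
  · refine Finset.sum_congr (Finset.ext fun T => ?_) fun _ _ => rfl
    simp only [Finset.mem_filter, Finset.mem_powerset, Finset.subset_erase]
    have := fun h : i ∈ ω.leaders T => (ω.mem_leaders_iff.1 h).1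
    grind

theorem rankPotential_erase_of_rank_lt {i : N} {k : Fin ω.numParts} (hk : ω.rank i < k)
    (S : Finset N) : ω.rankPotential W k (S.erase i) = ω.rankPotential W k S := by
  classical
  refine Finset.sum_congr (Finset.ext fun T => ?_) fun _ _ => rfl
  simp only [Finset.mem_filter, Finset.mem_powerset, Finset.subset_erase]
  refine ⟨fun hT => ⟨hT.1.1, hT.2⟩, ?_⟩
  rintro ⟨hTS, j, hj, rfl⟩
  exact ⟨⟨hTS, fun hi => hk.not_ge ((ω.mem_leaders_iff.1 hj).2 i hi)⟩, j, hj, rfl⟩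

end WeightSystem

namespace WelfareGame

variable {N : Type*} [Fintype N] (G : WelfareGame N)

theorem utility_eq_sum_univ (i : N) (a : N → Finset G.Resource) :
    G.utility i a = ∑ r, G.rule r i (G.users a r) :=
  Finset.sum_subset (Finset.subset_univ _) fun r _ hr =>
    (G.rule r).share_eq_zero i _ (by simpa [users] using hr)

variable [DecidableEq N]

theorem erase_users_update (a : N → Finset G.Resource) (i : N) (b : Finset G.Resource)
    (r : G.Resource) : (G.users (Function.update a i b) r).erase i = (G.users a r).erase i := by
  ext j
  by_cases h : j = i <;> simp [users, h]

theorem exists_isNashEquilibrium_of_potential {α : Type*} [Preorder α]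
    (P : (N → Finset G.Resource) → α)
    (hP : ∀ a i b, G.utility i a < G.utility i (Function.update a i b) →
      P a < P (Function.update a i b)) : ∃ a, G.IsNashEquilibrium a := by
  have hne : {a : N → Finset G.Resource | ∀ i, a i ∈ G.actions i}.Nonempty :=
    ⟨fun i => (G.actions_nonempty i).some, fun i => (G.actions_nonempty i).some_mem⟩
  obtain ⟨a, ha, hmax⟩ := Set.Finite.exists_maximalFor P _ (Set.toFinite _) hne
  refine ⟨a, ha, fun i b hb => le_of_not_gt fun hlt => ?_⟩
  have hadm : ∀ j, Function.update a i b j ∈ G.actions j :=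
    (Function.forall_update_iff a fun j s => s ∈ G.actions j).2 ⟨hb, fun j _ => ha j⟩
  exact (hP a i b hlt).not_ge (hmax hadm (hP a i b hlt).le)

variable (ω : WeightSystem N) (V : G.Resource → Welfare N)

/-- The vector of the rank potentials of all resources, compared lexicographically from the highest
rank down: a deviation of a player leaves the potentials of all higher ranks unchanged. -/
noncomputable def lexPotential (a : N → Finset G.Resource) :
    Lex ((Fin ω.numParts)ᵒᵈ → ℝ) :=
  toLex fun k => ∑ r, ω.rankPotential (V r) (OrderDual.ofDual k) (G.users a r)

variable {G ω V}

theorem sum_rankPotential_rank (hV : ∀ r, G.rule r = gwsv ω (V r)) (i : N)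
    (a : N → Finset G.Resource) :
    ∑ r, ω.rankPotential (V r) (ω.rank i) (G.users a r) = (ω.weight i)⁻¹ * G.utility i a +
      ∑ r, ω.rankPotential (V r) (ω.rank i) ((G.users a r).erase i) := by
  rw [G.utility_eq_sum_univ, Finset.mul_sum, ← Finset.sum_add_distrib]
  exact Finset.sum_congr rfl fun r _ => by rw [ω.rankPotential_rank, hV]

theorem lexPotential_lt_of_utility_lt (hV : ∀ r, G.rule r = gwsv ω (V r))
    {a : N → Finset G.Resource} {i : N} {b : Finset G.Resource}
    (hlt : G.utility i a < G.utility i (Function.update a i b)) :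
    G.lexPotential ω V a < G.lexPotential ω V (Function.update a i b) := by
  refine ⟨OrderDual.toDual (ω.rank i), fun k hk => ?_, ?_⟩
  · have hk' : ω.rank i < OrderDual.ofDual k := hk
    refine Finset.sum_congr rfl fun r _ => ?_
    rw [← ω.rankPotential_erase_of_rank_lt _ hk', ← G.erase_users_update a i b,
      ω.rankPotential_erase_of_rank_lt _ hk']
  · change ∑ r, ω.rankPotential (V r) (ω.rank i) (G.users a r) <
      ∑ r, ω.rankPotential (V r) (ω.rank i) (G.users (Function.update a i b) r)
    rw [sum_rankPotential_rank hV, sum_rankPotential_rank hV]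
    simp only [G.erase_users_update]
    gcongr
    exact inv_pos.2 (ω.weight_pos i)

theorem exists_isNashEquilibrium_of_rule_eq_gwsv (hV : ∀ r, G.rule r = gwsv ω (V r)) :
    ∃ a, G.IsNashEquilibrium a :=
  G.exists_isNashEquilibrium_of_potential (G.lexPotential ω V) fun _ _ _ =>
    lexPotential_lt_of_utility_lt hV

end WelfareGame

/-! ### Stable matrices -/

section Span

theorem tendsto_intFloor_mul_div_atTop {R : Type*} [Field R] [LinearOrder R]
    [IsStrictOrderedRing R] [TopologicalSpace R] [OrderTopology R] [FloorRing R] (a : R) :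
    Filter.Tendsto (fun x => (⌊a * x⌋ : R) / x) Filter.atTop (nhds a) := by
  have hlower : Filter.Tendsto (fun x : R => a - x⁻¹) Filter.atTop (nhds a) := by
    simpa using tendsto_const_nhds.sub (tendsto_inv_atTop_zero (𝕜 := R))
  refine tendsto_of_tendsto_of_tendsto_of_le_of_le' hlower tendsto_const_nhds ?_ ?_
  · filter_upwards [Filter.eventually_gt_atTop 0] with x hx
    rw [le_div_iff₀ hx, sub_mul, inv_mul_cancel₀ hx.ne']
    exact (Int.sub_one_lt_floor _).le
  · filter_upwards [Filter.eventually_gt_atTop 0] with x hx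
    exact (div_le_iff₀ hx).2 (Int.floor_le _)

/-- A real combination `∑ aₗ • sₗ` is the limit of `x⁻¹ • ∑ ⌊aₗ x⌋ • sₗ` as `x → ∞`. -/
theorem span_subset_of_addSubgroup_closure_subset {E : Type*} [AddCommGroup E] [Module ℝ E]
    [TopologicalSpace E] [ContinuousAdd E] [ContinuousSMul ℝ E] {S C : Set E} (hC : IsClosed C)
    (hsmul : ∀ x ∈ C, ∀ t : ℝ, 0 ≤ t → t • x ∈ C) (hS : (AddSubgroup.closure S : Set E) ⊆ C) :
    (Submodule.span ℝ S : Set E) ⊆ C := by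
  intro x hx
  obtain ⟨n, a, s, rfl⟩ := Submodule.mem_span_set'.1 hx
  have hlim : Filter.Tendsto (fun t : ℝ => ∑ l, ((⌊a l * t⌋ : ℝ) / t) • (s l : E)) Filter.atTop
      (nhds (∑ l, a l • (s l : E))) :=
    tendsto_finsetSum _ fun l _ => (tendsto_intFloor_mul_div_atTop (a l)).smul_const _
  refine hC.mem_of_tendsto hlim ?_
  filter_upwards [Filter.eventually_ge_atTop 0] with t ht
  have hint : ∑ l, ⌊a l * t⌋ • (s l : E) ∈ C :=
    hS (sum_mem fun l _ => zsmul_mem (AddSubgroup.subset_closure (s l).2) _)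
  convert hsmul _ hint t⁻¹ (inv_nonneg.2 ht) using 1
  rw [Finset.smul_sum]
  refine Finset.sum_congr rfl fun l _ => ?_
  rw [← Int.cast_smul_eq_zsmul ℝ, smul_smul, div_eq_inv_mul]

end Span

section PairMatrix

variable {N : Type*} [DecidableEq N]

/-- The matrix of an interaction of two players `i` and `j` only, of strength `p` for `i` and `q`
for `j`. -/
def pairMatrix (i j : N) (p q : ℝ) : Matrix N N ℝ :=
  Matrix.single i j p + Matrix.single j i q

theorem smul_pairMatrix (t : ℝ) (i j : N) (p q : ℝ) :
    t • pairMatrix i j p q = pairMatrix i j (t * p) (t * q) := by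
  simp [pairMatrix, Matrix.smul_single]

end PairMatrix

section Stable

variable {N : Type*} [Fintype N]

/-- The utility of the player `k` at the signs `x` in the game in which it receives `c k l` from
every player `l` of the same sign and `-c k l` from every player `l` of the opposite sign. -/
def alignment (x : N → ℤˣ) (k : N) : Matrix N N ℝ →ₗ[ℝ] ℝ :=
  ∑ l, ((x k : ℝ) * (x l : ℝ)) • Matrix.entryLinearMap ℝ ℝ k l

variable (N) in
/-- The matrices `c` for which the game of choosing signs has a pure Nash equilibrium. If
`c k k = 0`, then a change of its own sign negates the utility of the player `k`, hence the
condition that the utilities are nonnegative. -/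
def stableMatrices : Set (Matrix N N ℝ) :=
  {c | ∃ x : N → ℤˣ, ∀ k, 0 ≤ alignment x k c}

theorem isClosed_stableMatrices : IsClosed (stableMatrices N) := by
  classical
  have hunion : stableMatrices N = ⋃ x : N → ℤˣ, ⋂ k, {c | 0 ≤ alignment x k c} := by
    ext c
    simp [stableMatrices]
  rw [hunion]
  exact isClosed_iUnion_of_finite fun x => isClosed_iInter fun k =>
    isClosed_le continuous_const (alignment x k).continuous_of_finiteDimensional

theorem smul_mem_stableMatrices {c : Matrix N N ℝ} (hc : c ∈ stableMatrices N) {t : ℝ}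
    (ht : 0 ≤ t) : t • c ∈ stableMatrices N := by
  obtain ⟨x, hx⟩ := hc
  exact ⟨x, fun k => by rw [map_smul]; exact mul_nonneg ht (hx k)⟩

variable [DecidableEq N]

theorem alignment_pairMatrix (x : N → ℤˣ) (k i j : N) (p q : ℝ) :
    alignment x k (pairMatrix i j p q) =
      x i * x j * ((if k = i then p else 0) + if k = j then q else 0) := by
  have hsingle : ∀ (i j : N) (p : ℝ),
      alignment x k (Matrix.single i j p) = x i * x j * if k = i then p else 0 := by
    intro i j p
    rcases eq_or_ne k i with rfl | hk <;>
      simp [alignment, Matrix.single_apply, *, Ne.symm]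
  rw [pairMatrix, map_add, hsingle, hsingle, mul_add, mul_comm (x j : ℝ)]

end Stable

/-! ### Gadget games -/

/-- A building block of games. It has one resource for every sign `b`, with the welfare `welfare`.
The player `fst` uses the resource of its own sign, `snd` the resource of its own sign times `sign`,
the players of `common` use both resources, and all other players none. -/
structure Gadget {N : Type*} (𝕎 : Set (Welfare N)) where
  welfare : 𝕎
  fst : N
  snd : N
  common : Finset N
  sign : ℤˣ
  fst_ne_snd : fst ≠ snd
  fst_notMem : fst ∉ common
  snd_notMem : snd ∉ common

namespace Gadget

variable {N : Type*} {𝕎 : Set (Welfare N)} (g : Gadget 𝕎)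

/-- The player `k` with the sign `y` uses the resource of `g` for the sign `b`. -/
def Uses (k : N) (y b : ℤˣ) : Prop :=
  k = g.fst ∧ y = b ∨ k = g.snd ∧ y = g.sign * b ∨ k ∈ g.common

instance [DecidableEq N] (k : N) (y b : ℤˣ) : Decidable (g.Uses k y b) :=
  inferInstanceAs (Decidable (_ ∨ _ ∨ _))

/-- The gadget with the roles of `fst` and `snd` exchanged. -/
def swap : Gadget 𝕎 where
  welfare := g.welfare
  fst := g.snd
  snd := g.fst
  common := g.common
  sign := g.sign
  fst_ne_snd := g.fst_ne_snd.symm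
  fst_notMem := g.snd_notMem
  snd_notMem := g.fst_notMem

variable (f : 𝕎 → DistributionRule N) [DecidableEq N]

/-- The interaction matrix of the gadget. -/
def matrix : Matrix N N ℝ :=
  (g.sign : ℝ) • pairMatrix g.fst g.snd ((f g.welfare).influence g.fst g.snd g.common)
    ((f g.welfare).influence g.snd g.fst g.common)

variable [Fintype N]

/-- The players that use the resource of `g` for the sign `b` when the players have the signs
`x`. -/
def users (x : N → ℤˣ) (b : ℤˣ) : Finset N :=
  Finset.univ.filter fun k => g.Uses k (x k) b

variable {g} in
theorem mem_users {k : N} {x : N → ℤˣ} {b : ℤˣ} : k ∈ g.users x b ↔ g.Uses k (x k) b := by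
  simp [users]

/-- The total share of the player `k` at the two resources of `g`. -/
def payoff (k : N) (x : N → ℤˣ) : ℝ :=
  ∑ b : ℤˣ, f g.welfare k (g.users x b)

theorem payoff_swap (k : N) (x : N → ℤˣ) : g.swap.payoff f k x = g.payoff f k x := by
  refine Fintype.sum_equiv (Equiv.mulLeft g.sign) _ _ fun b => ?_
  congr 1
  ext l
  simp only [mem_users, Uses, swap, Equiv.coe_mulLeft, ← mul_assoc, Int.units_mul_self, one_mul]
  tauto

theorem payoff_fst (x : N → ℤˣ) :
    g.payoff f g.fst x = if x g.snd = g.sign * x g.fst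
      then f g.welfare g.fst (insert g.fst (insert g.snd g.common))
      else f g.welfare g.fst (insert g.fst g.common) := by
  have hfst := g.fst_ne_snd
  have hmem := g.fst_notMem
  rw [payoff, Finset.sum_eq_single (x g.fst)]
  · rw [← apply_ite (f g.welfare g.fst)]
    congr 1
    ext l
    simp only [mem_users, Uses]
    split_ifs <;> grind
  · exact fun b _ hb => (f g.welfare).share_eq_zero _ _
      (by simp [mem_users, Uses, hfst, hmem, hb.symm])
  · exact fun h => absurd (Finset.mem_univ _) h

theorem payoff_fst_sub_payoff_fst_update (x : N → ℤˣ) :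
    g.payoff f g.fst x - g.payoff f g.fst (Function.update x g.fst (-x g.fst)) =
      g.sign * (x g.fst * x g.snd) * (f g.welfare).influence g.fst g.snd g.common := by
  rw [payoff_fst, payoff_fst, Function.update_self, Function.update_of_ne g.fst_ne_snd.symm,
    DistributionRule.influence]
  rcases Int.units_eq_one_or g.sign with hs | hs <;>
    rcases Int.units_eq_one_or (x g.fst) with hi | hi <;>
    rcases Int.units_eq_one_or (x g.snd) with hj | hj <;>
    simp [hs, hi, hj]

theorem payoff_update_of_ne {k : N} (hfst : k ≠ g.fst) (hsnd : k ≠ g.snd) (x : N → ℤˣ) (y : ℤˣ) :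
    g.payoff f k (Function.update x k y) = g.payoff f k x := by
  refine Finset.sum_congr rfl fun b _ => congrArg _ (Finset.filter_congr fun l _ => ?_)
  rcases eq_or_ne l k with rfl | hl
  · simp [Uses, hfst, hsnd]
  · rw [Function.update_of_ne hl]

theorem payoff_sub_payoff_update (k : N) (x : N → ℤˣ) :
    g.payoff f k x - g.payoff f k (Function.update x k (-x k)) =
      alignment x k (g.matrix f) := by
  rw [matrix, map_smul, alignment_pairMatrix, smul_eq_mul]
  by_cases hfst : k = g.fst
  · subst hfst
    rw [payoff_fst_sub_payoff_fst_update]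
    simp [g.fst_ne_snd, mul_assoc]
  by_cases hsnd : k = g.snd
  · subst hsnd
    have hswap := g.swap.payoff_fst_sub_payoff_fst_update f x
    rw [payoff_swap, payoff_swap] at hswap
    refine hswap.trans ?_
    simp only [swap, hfst, if_true, if_false, zero_add]
    ring
  · simp [g.payoff_update_of_ne f hfst hsnd, hfst, hsnd]

end Gadget

section GadgetGame

variable {N : Type*} [Fintype N] [DecidableEq N] {𝕎 : Set (Welfare N)}
  (f : 𝕎 → DistributionRule N) {ι : Type} [Fintype ι] [DecidableEq ι] (g : ι → Gadget 𝕎)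

/-- The resources that the player `k` uses in the gadgets `g` when it chooses the sign `y`. -/
def gadgetAction (k : N) (y : ℤˣ) : Finset (ι × ℤˣ) :=
  Finset.univ.filter fun r => (g r.1).Uses k y r.2

/-- The game in which every player chooses one sign for all gadgets of the family `g`. -/
abbrev gadgetGame [Nonempty ι] : WelfareGame N where
  Resource := ι × ℤˣ
  one_lt_card := by
    have : Nontrivial ℤˣ := ⟨1, -1, by decide⟩
    have : Nontrivial (ι × ℤˣ) := nontrivial_prod_right
    exact Fintype.one_lt_card
  actions k := Set.range (gadgetAction g k)
  actions_nonempty _ := Set.range_nonempty _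
  welfare r := (g r.1).welfare
  rule r := f (g r.1).welfare
  rule_eq_of_welfare_eq _ _ h := congrArg f (Subtype.ext h)

omit [Fintype N] in
theorem gadgetGame_mem_gameClass [Nonempty ι] : gadgetGame f g ∈ gameClass 𝕎 f :=
  fun r => ⟨(g r.1).welfare.2, rfl⟩

theorem utility_gadgetGame [Nonempty ι] (k : N) (x : N → ℤˣ) :
    (gadgetGame f g).utility k (fun l => gadgetAction g l (x l)) = ∑ p, (g p).payoff f k x := by
  rw [WelfareGame.utility_eq_sum_univ]
  refine (Fintype.sum_prod_type _).trans ?_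
  refine Finset.sum_congr rfl fun p _ => Finset.sum_congr rfl fun b _ => congrArg _ ?_
  ext l
  simp [WelfareGame.users, gadgetAction, Gadget.mem_users]

variable {f}

omit [DecidableEq ι] in
theorem sum_matrix_mem_stableMatrices
    (hf : ∀ G ∈ gameClass 𝕎 f, ∃ a, G.IsNashEquilibrium a) :
    ∑ p, (g p).matrix f ∈ stableMatrices N := by
  classical
  rcases isEmpty_or_nonempty ι with hι | hι
  · exact ⟨1, fun k => by simp⟩
  obtain ⟨a, ha, hnash⟩ := hf _ (gadgetGame_mem_gameClass f g)
  choose x hx using ha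
  obtain rfl : (fun l => gadgetAction g l (x l)) = a := funext hx
  refine ⟨x, fun k => ?_⟩
  have hupdate : Function.update (fun l => gadgetAction g l (x l)) k (gadgetAction g k (-x k)) =
      fun l => gadgetAction g l (Function.update x k (-x k) l) :=
    funext fun l => (Function.apply_update (fun l => gadgetAction g l) x k (-x k) l).symm
  have hdev := hupdate ▸ hnash k (gadgetAction g k (-x k)) ⟨_, rfl⟩
  rw [utility_gadgetGame, utility_gadgetGame, ← sub_nonneg, ← Finset.sum_sub_distrib] at hdev
  simpa only [map_sum, ← Gadget.payoff_sub_payoff_update] using hdev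

end GadgetGame

section InteractionSpan

variable {N : Type*} [DecidableEq N] {𝕎 : Set (Welfare N)} {f : 𝕎 → DistributionRule N}

theorem exists_sum_matrix_eq_of_mem_closure {c : Matrix N N ℝ}
    (hc : c ∈ AddSubgroup.closure (Set.range fun g : Gadget 𝕎 => g.matrix f)) :
    ∃ (ι : Type) (_ : Fintype ι) (g : ι → Gadget 𝕎), ∑ p, (g p).matrix f = c := by
  induction hc using AddSubgroup.closure_induction with
  | mem c hc =>
    obtain ⟨g, rfl⟩ := hc
    exact ⟨Unit, inferInstance, fun _ => g, by simp⟩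
  | zero => exact ⟨Empty, inferInstance, Empty.elim, by simp⟩
  | add c d _ _ hc hd =>
    obtain ⟨ι, _, g, rfl⟩ := hc
    obtain ⟨κ, _, h, rfl⟩ := hd
    exact ⟨ι ⊕ κ, inferInstance, Sum.elim g h, by simp⟩
  | neg c _ hc =>
    obtain ⟨ι, _, g, rfl⟩ := hc
    exact ⟨ι, inferInstance, fun p => { g p with sign := -(g p).sign }, by simp [Gadget.matrix]⟩

theorem span_range_matrix_subset_stableMatrices [Fintype N]
    (hf : ∀ G ∈ gameClass 𝕎 f, ∃ a, G.IsNashEquilibrium a) :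
    (Submodule.span ℝ (Set.range fun g : Gadget 𝕎 => g.matrix f) : Set (Matrix N N ℝ)) ⊆
      stableMatrices N := by
  refine span_subset_of_addSubgroup_closure_subset isClosed_stableMatrices
    (fun c hc t ht => smul_mem_stableMatrices hc ht) fun c hc => ?_
  obtain ⟨ι, _, g, rfl⟩ := exists_sum_matrix_eq_of_mem_closure hc
  exact sum_matrix_mem_stableMatrices g hf

theorem pairMatrix_moebius_mem_span (W : 𝕎) {i j : N} (hij : i ≠ j) {T : Finset N} (hi : i ∈ T)
    (hj : j ∈ T) :
    pairMatrix i j (moebius (f W i) T) (moebius (f W j) T) ∈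
      Submodule.span ℝ (Set.range fun g : Gadget 𝕎 => g.matrix f) := by
  obtain ⟨K, hiK, hjK, rfl⟩ : ∃ K, i ∉ K ∧ j ∉ K ∧ insert i (insert j K) = T :=
    ⟨(T.erase i).erase j, by simp, by simp, by
      rw [Finset.insert_erase (Finset.mem_erase.2 ⟨hij.symm, hj⟩), Finset.insert_erase hi]⟩
  rw [(f W).moebius_insert_insert hij hiK hjK, Finset.insert_comm,
    (f W).moebius_insert_insert hij.symm hjK hiK]
  have hsum : pairMatrix i j (moebius ((f W).influence i j) K) (moebius ((f W).influence j i) K) =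
      ∑ Q ∈ K.powerset, (-1 : ℝ) ^ (K.card - Q.card) •
        pairMatrix i j ((f W).influence i j Q) ((f W).influence j i Q) := by
    simp only [smul_pairMatrix]
    simp only [pairMatrix, Finset.sum_add_distrib]
    exact congrArg₂ _ (map_sum (Matrix.singleAddMonoidHom (α := ℝ) i j) _ _)
      (map_sum (Matrix.singleAddMonoidHom (α := ℝ) j i) _ _)
  rw [hsum]
  refine Submodule.sum_mem _ fun Q hQ => Submodule.smul_mem _ _ (Submodule.subset_span ?_)
  have hQK := Finset.mem_powerset.1 hQ
  exact ⟨⟨W, i, j, Q, 1, hij, fun h => hiK (hQK h), fun h => hjK (hQK h)⟩,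
    by simp [Gadget.matrix]⟩

end InteractionSpan

/-! ### Gains of walks -/

/-- A walk from `i` to `j` of gain `g` in the graph whose edges `R i j ρ` lead from `i` to `j` with
the gain `ρ`; gains multiply along walks. -/
inductive Walk {N M : Type*} [Monoid M] (R : N → N → M → Prop) : N → N → M → Prop
  | nil (i : N) : Walk R i i 1
  | cons {i j k : N} {ρ g : M} : R i j ρ → Walk R j k g → Walk R i k (ρ * g)

namespace Walk

variable {N : Type*} {i j k : N}

theorem single {M : Type*} [Monoid M] {R : N → N → M → Prop} {ρ : M} (h : R i j ρ) :
    Walk R i j ρ := by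
  simpa using cons h (nil j)

theorem trans {M : Type*} [Monoid M] {R : N → N → M → Prop} {g h : M} (hg : Walk R i j g)
    (hh : Walk R j k h) : Walk R i k (g * h) := by
  induction hg with
  | nil => rwa [one_mul]
  | cons hρ _ ih => rw [mul_assoc]; exact cons hρ (ih hh)

theorem reverse {G : Type*} [GroupWithZero G] {R : N → N → G → Prop}
    (hR : ∀ ⦃i j ρ⦄, R i j ρ → ρ ≠ 0 → R j i ρ⁻¹) {g : G} (hg : Walk R i j g) (h0 : g ≠ 0) :
    Walk R j i g⁻¹ := by
  induction hg with
  | nil => rw [inv_one]; exact nil _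
  | cons hρ _ ih =>
    rw [mul_inv_rev]
    exact (ih (right_ne_zero_of_mul h0)).trans (single (hR hρ (left_ne_zero_of_mul h0)))

end Walk

/-- The vertices `v 0, …, v n` form a path without repetitions, with the edge gains
`ρ 0, …, ρ (n - 1)`; the other values of `v` and `ρ` are irrelevant. -/
structure IsSimplePath {N M : Type*} (R : N → N → M → Prop) (n : ℕ) (v : ℕ → N) (ρ : ℕ → M) :
    Prop where
  step : ∀ l < n, R (v l) (v (l + 1)) (ρ l)
  injOn : Set.InjOn v (Set.Iic n)

namespace IsSimplePath

variable {N M : Type*} {R : N → N → M → Prop} {m n : ℕ} {v : ℕ → N} {ρ : ℕ → M}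

theorem take (h : IsSimplePath R n v ρ) (hmn : m ≤ n) : IsSimplePath R m v ρ :=
  ⟨fun l hl => h.step l (hl.trans_le hmn), h.injOn.mono (Set.Iic_subset_Iic.2 hmn)⟩

theorem drop (h : IsSimplePath R n v ρ) (hmn : m ≤ n) :
    IsSimplePath R (n - m) (fun l => v (m + l)) fun l => ρ (m + l) where
  step l hl := h.step (m + l) (by omega)
  injOn k hk l hl hkl := by
    simp only [Set.mem_Iic] at hk hl
    exact Nat.add_left_cancel
      (h.injOn (Set.mem_Iic.2 (by omega)) (Set.mem_Iic.2 (by omega)) hkl)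

theorem cons (h : IsSimplePath R n v ρ) {i : N} {τ : M} (hτ : R i (v 0) τ)
    (hi : ∀ l ≤ n, v l ≠ i) : IsSimplePath R (n + 1) (fun l => l.casesOn i v)
    fun l => l.casesOn τ ρ where
  step
    | 0, _ => hτ
    | l + 1, hl => h.step l (Nat.lt_of_succ_lt_succ hl)
  injOn
    | 0, _, 0, _, _ => rfl
    | 0, _, l + 1, hl, hil => absurd hil.symm (hi l (Nat.le_of_succ_le_succ hl))
    | k + 1, hk, 0, _, hki => absurd hki (hi k (Nat.le_of_succ_le_succ hk))
    | _ + 1, hk, _ + 1, hl, hkl => congrArg Nat.succ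
      (h.injOn (Nat.le_of_succ_le_succ hk) (Nat.le_of_succ_le_succ hl) hkl)

end IsSimplePath

namespace Walk

variable {N M : Type*} [Field M] [LinearOrder M] [IsStrictOrderedRing M]
  {R : N → N → M → Prop} {i j : N} {g : M}

theorem nonneg (hR : ∀ ⦃i j ρ⦄, R i j ρ → 0 ≤ ρ) (hg : Walk R i j g) : 0 ≤ g := by
  induction hg with
  | nil => exact zero_le_one
  | cons hρ _ ih => exact mul_nonneg (hR hρ) ih

/-- The path arises from the walk by removing cycles. -/
theorem exists_isSimplePath (hR : ∀ ⦃i j ρ⦄, R i j ρ → 0 ≤ ρ)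
    (hcycle : ∀ ⦃n v ρ τ⦄, IsSimplePath R n v ρ → R (v n) (v 0) τ →
      1 ≤ (∏ l ∈ Finset.range n, ρ l) * τ) (hg : Walk R i j g) :
    ∃ n v ρ, IsSimplePath R n v ρ ∧ v 0 = i ∧ v n = j ∧ ∏ l ∈ Finset.range n, ρ l ≤ g := by
  induction hg with
  | nil i =>
    refine ⟨0, fun _ => i, 1, ⟨fun l hl => absurd hl l.not_lt_zero, ?_⟩, rfl, rfl, by simp⟩
    exact fun k hk l hl _ => (Nat.le_zero.1 hk).trans (Nat.le_zero.1 hl).symm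
  | @cons i _ _ τ g hτ hg ih =>
    obtain ⟨n, v, ρ, hpath, rfl, rfl, hle⟩ := ih
    have hτg := mul_le_mul_of_nonneg_left hle (hR hτ)
    by_cases hi : ∃ m ≤ n, v m = i
    · obtain ⟨m, hmn, rfl⟩ := hi
      refine ⟨n - m, _, _, hpath.drop hmn, rfl, by simp [hmn], ?_⟩
      have hone := hcycle (hpath.take hmn) hτ
      have hnonneg : 0 ≤ ∏ l ∈ Finset.range (n - m), ρ (m + l) :=
        Finset.prod_nonneg fun l hl => hR ((hpath.drop hmn).step l (Finset.mem_range.1 hl))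
      have hsplit : ∏ l ∈ Finset.range n, ρ l =
          (∏ l ∈ Finset.range m, ρ l) * ∏ l ∈ Finset.range (n - m), ρ (m + l) := by
        rw [← Finset.prod_range_add, Nat.add_sub_cancel' hmn]
      calc ∏ l ∈ Finset.range (n - m), ρ (m + l)
          ≤ (∏ l ∈ Finset.range m, ρ l) * τ * ∏ l ∈ Finset.range (n - m), ρ (m + l) :=
            le_mul_of_one_le_left hnonneg hone
        _ = τ * ∏ l ∈ Finset.range n, ρ l := by rw [hsplit]; ring
        _ ≤ τ * g := hτg
    · push Not at hi
      refine ⟨n + 1, _, _, hpath.cons hτ hi, rfl, rfl, ?_⟩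
      rw [Finset.prod_range_succ', mul_comm]
      exact hτg

theorem gain_eq_one (hR : ∀ ⦃i j ρ⦄, R i j ρ → 0 ≤ ρ)
    (hinv : ∀ ⦃i j ρ⦄, R i j ρ → ρ ≠ 0 → R j i ρ⁻¹)
    (hcycle : ∀ ⦃n v ρ τ⦄, IsSimplePath R n v ρ → R (v n) (v 0) τ →
      1 ≤ (∏ l ∈ Finset.range n, ρ l) * τ) (hg : Walk R i i g) : g = 1 := by
  have one_le : ∀ ⦃g⦄, Walk R i i g → 1 ≤ g := fun g hg => by
    obtain ⟨n, v, ρ, hpath, h0, hn, hle⟩ := hg.exists_isSimplePath hR hcycle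
    obtain rfl : 0 = n := hpath.injOn (Set.mem_Iic.2 n.zero_le) (Set.mem_Iic.2 le_rfl)
      (h0.trans hn.symm)
    simpa using hle
  have hpos : 0 < g := one_pos.trans_le (one_le hg)
  exact (one_le hg).antisymm' ((one_le_inv₀ hpos).1 (one_le (hg.reverse hinv hpos.ne')))

theorem exists_weight (hR : ∀ ⦃i j ρ⦄, R i j ρ → 0 ≤ ρ)
    (hinv : ∀ ⦃i j ρ⦄, R i j ρ → ρ ≠ 0 → R j i ρ⁻¹)
    (hclosed : ∀ ⦃i g⦄, Walk R i i g → g = 1) :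
    ∃ weight : N → M, (∀ i, 0 < weight i) ∧
      ∀ ⦃i j ρ⦄, R i j ρ → ρ ≠ 0 → weight j = weight i * ρ := by
  let s : Setoid N :=
    { r i j := ∃ g, Walk R i j g ∧ g ≠ 0
      iseqv :=
        { refl i := ⟨1, nil i, one_ne_zero⟩
          symm := fun ⟨g, hg, h0⟩ => ⟨g⁻¹, hg.reverse hinv h0, inv_ne_zero h0⟩
          trans := fun ⟨g, hg, hg0⟩ ⟨h, hh, hh0⟩ => ⟨g * h, hg.trans hh, mul_ne_zero hg0 hh0⟩ } }
  choose weight hwalk hne using fun i => Quotient.mk_out (s := s) i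
  refine ⟨weight, fun i => (hwalk i).nonneg hR |>.lt_of_ne' (hne i), fun i j ρ hρ h0 => ?_⟩
  have hij : (⟦i⟧ : Quotient s).out = (⟦j⟧ : Quotient s).out :=
    congrArg _ (Quotient.sound ⟨ρ, single hρ, h0⟩)
  have hone := hclosed (((hwalk i).trans (single hρ)).trans (hij ▸ (hwalk j).reverse hinv (hne j)))
  exact ((mul_inv_eq_one₀ (hne j)).1 hone).symm

end Walk

theorem exists_weightSystem_respects {N : Type*} [Finite N] {R : N → N → ℝ → Prop}
    (hR : ∀ ⦃i j ρ⦄, R i j ρ → 0 ≤ ρ) (hinv : ∀ ⦃i j ρ⦄, R i j ρ → ρ ≠ 0 → R j i ρ⁻¹)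
    (hclosed : ∀ ⦃i g⦄, Walk R i i g → g = 1) :
    ∃ ω : WeightSystem N, ∀ ⦃i j ρ⦄, R i j ρ → ω.Respects i j 1 ρ := by
  have := Fintype.ofFinite N
  obtain ⟨weight, hpos, hweight⟩ := Walk.exists_weight hR hinv hclosed
  let sources (i : N) : Set N := {k | ∃ g, Walk R k i g}
  have hsub : ∀ {i j ρ}, R i j ρ → sources i ⊆ sources j := fun hρ _ ⟨_, hg⟩ =>
    ⟨_, hg.trans (.single hρ)⟩
  refine ⟨.ofRank weight hpos fun i => (sources i).ncard, fun i j ρ hρ _ => ⟨?_, fun h0 => ?_⟩⟩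
  · rintro rfl
    have hnot : j ∉ sources i := fun ⟨g, hg⟩ =>
      zero_ne_one ((zero_mul g).symm.trans (hclosed (.cons hρ hg)))
    rw [← not_le, WeightSystem.rank_ofRank_le_iff, not_le]
    exact Set.ncard_lt_ncard ⟨hsub hρ, fun h => hnot (h ⟨1, .nil j⟩)⟩
  · have heq : sources i = sources j := (hsub hρ).antisymm (hsub (hinv hρ h0))
    refine ⟨le_antisymm ?_ ?_, by simpa [WeightSystem.ofRank] using hweight hρ h0⟩ <;>
      rw [WeightSystem.rank_ofRank_le_iff, heq]

/-! ### Interactions along cycles -/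

section InteractionRatio

variable {N : Type*} [DecidableEq N] {E : Submodule ℝ (Matrix N N ℝ)}

variable (E) in
/-- The edges of the graph whose walks are chains of interactions in `E`: a player `i` is related to
another player `j` with the gain `ρ` if `E` contains their interaction of the strengths `1` for `i`
and `ρ` for `j`. -/
def InteractionRatio (i j : N) (ρ : ℝ) : Prop :=
  i ≠ j ∧ pairMatrix i j 1 ρ ∈ E

theorem InteractionRatio.of_pairMatrix_mem {i j : N} (hij : i ≠ j) {p q : ℝ} (hp : p ≠ 0)
    (h : pairMatrix i j p q ∈ E) : InteractionRatio E i j (p⁻¹ * q) := by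
  refine ⟨hij, ?_⟩
  rw [← inv_mul_cancel₀ hp, ← smul_pairMatrix]
  exact E.smul_mem _ h

theorem InteractionRatio.symm {i j : N} {ρ : ℝ} (h : InteractionRatio E i j ρ) (h0 : ρ ≠ 0) :
    InteractionRatio E j i ρ⁻¹ := by
  have hmem : pairMatrix j i ρ 1 ∈ E := by
    rw [pairMatrix, add_comm]
    exact h.2
  simpa using of_pairMatrix_mem h.1.symm h0 hmem

end InteractionRatio

section Cycle

theorem units_eq_one_of_nonneg_add {u w : ℤˣ} {a b : ℝ} (hb : 0 ≤ b) (hba : b < a)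
    (h : 0 ≤ a * u + b * w) : u = 1 := by
  rcases Int.units_eq_one_or u with rfl | rfl
  · rfl
  · rcases Int.units_eq_one_or w with rfl | rfl <;>
      · simp only [Units.val_neg, Units.val_one, Int.cast_neg, Int.cast_one] at h
        linarith

variable {N : Type*} [Fintype N] [DecidableEq N]

theorem nonneg_of_pairMatrix_mem_stableMatrices {i j : N} (hij : i ≠ j) {ρ : ℝ}
    (h : pairMatrix i j 1 ρ ∈ stableMatrices N) : 0 ≤ ρ := by
  obtain ⟨x, hx⟩ := h
  have hi := hx i
  have hj := hx j
  rw [alignment_pairMatrix] at hi hj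
  rcases Int.units_eq_one_or (x i) with hxi | hxi <;>
    rcases Int.units_eq_one_or (x j) with hxj | hxj <;>
    simp [hij, hij.symm, hxi, hxj] at hi hj <;> linarith

variable {E : Submodule ℝ (Matrix N N ℝ)}

theorem exists_units_of_pairMatrix_mem (hE : (E : Set (Matrix N N ℝ)) ⊆ stableMatrices N)
    {ι : Type*} [Finite ι] {σ : Equiv.Perm ι} {v : ι → N} (hv : Function.Injective v)
    {ρ t : ι → ℝ} (hρ : ∀ l, 0 ≤ ρ l) (hmem : ∀ l, pairMatrix (v l) (v (σ l)) 1 (ρ l) ∈ E)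
    (ht : ∀ l, 0 < t l) (hlt : ∀ l, ρ l * t l < t (σ l)) (s : ι → ℤˣ) :
    ∃ y : ι → ℤˣ, ∀ l, s l * (y l * y (σ l)) = 1 := by
  classical
  have := Fintype.ofFinite ι
  obtain ⟨x, hx⟩ := hE (E.sum_mem fun l (_ : l ∈ Finset.univ) =>
    E.smul_mem (s l * t l : ℝ) (hmem l))
  refine ⟨fun l => x (v l), fun l => ?_⟩
  obtain ⟨l, rfl⟩ := σ.surjective l
  refine units_eq_one_of_nonneg_add (w := s l * (x (v l) * x (v (σ l))))
    (mul_nonneg (hρ l) (ht l).le) (hlt l) ?_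
  have hl := hx (v (σ l))
  simp only [map_sum, map_smul, alignment_pairMatrix, hv.eq_iff, σ.injective.eq_iff, mul_add,
    smul_eq_mul, Finset.sum_add_distrib, mul_ite, mul_zero, Finset.sum_ite_eq, Finset.mem_univ,
    if_true] at hl
  push_cast
  linarith

/-- Otherwise stability would provide, for all signs `s` of the interactions, signs `y` of the
players with `s l * (y l * y (σ l)) = 1` for all `l`, so that the product of `s` would be a
square. -/
theorem exists_le_mul_of_pairMatrix_mem (hE : (E : Set (Matrix N N ℝ)) ⊆ stableMatrices N)
    {ι : Type*} [Finite ι] [Nonempty ι] {σ : Equiv.Perm ι} {v : ι → N}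
    (hv : Function.Injective v) {ρ t : ι → ℝ} (hρ : ∀ l, 0 ≤ ρ l)
    (hmem : ∀ l, pairMatrix (v l) (v (σ l)) 1 (ρ l) ∈ E) (ht : ∀ l, 0 < t l) :
    ∃ l, t (σ l) ≤ ρ l * t l := by
  classical
  have := Fintype.ofFinite ι
  by_contra! hlt
  have hprod : ∀ s : ι → ℤˣ, ∏ l, s l = 1 := fun s => by
    obtain ⟨y, hy⟩ := exists_units_of_pairMatrix_mem hE hv hρ hmem ht hlt s
    have h := Finset.prod_congr rfl fun l (_ : l ∈ Finset.univ) => hy l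
    rwa [Finset.prod_mul_distrib, Finset.prod_mul_distrib, Equiv.prod_comp σ y,
      Int.units_mul_self, mul_one, Finset.prod_const_one] at h
  obtain ⟨l⟩ := ‹Nonempty ι›
  have h := hprod (Pi.mulSingle l (-1))
  rw [Finset.univ.prod_pi_mulSingle' l] at h
  simp at h

theorem exists_pos_prod_add_mul_lt_one {ι : Type*} (s : Finset ι) (ρ : ι → ℝ) {τ : ℝ}
    (h : (∏ l ∈ s, ρ l) * τ < 1) : ∃ δ > 0, (∏ l ∈ s, (ρ l + δ)) * τ < 1 := by
  have hcont : Continuous fun δ : ℝ => (∏ l ∈ s, (ρ l + δ)) * τ := by fun_prop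
  have hev : ∀ᶠ δ in nhds (0 : ℝ), (∏ l ∈ s, (ρ l + δ)) * τ < 1 :=
    hcont.continuousAt.eventually_lt continuousAt_const (by simpa using h)
  obtain ⟨δ, hδ, hpos⟩ := ((hev.filter_mono nhdsWithin_le_nhds).and
    (self_mem_nhdsWithin (s := Set.Ioi (0 : ℝ)))).exists
  exact ⟨δ, hpos, hδ⟩

theorem InteractionRatio.nonneg (hE : (E : Set (Matrix N N ℝ)) ⊆ stableMatrices N) {i j : N}
    {ρ : ℝ} (h : InteractionRatio E i j ρ) : 0 ≤ ρ :=
  nonneg_of_pairMatrix_mem_stableMatrices h.1 (hE h.2)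

theorem one_le_prod_mul_of_isSimplePath (hE : (E : Set (Matrix N N ℝ)) ⊆ stableMatrices N) {n : ℕ}
    {v : ℕ → N} {ρ : ℕ → ℝ} {τ : ℝ} (hpath : IsSimplePath (InteractionRatio E) n v ρ)
    (hτ : InteractionRatio E (v n) (v 0) τ) : 1 ≤ (∏ l ∈ Finset.range n, ρ l) * τ := by
  by_contra! hlt
  obtain ⟨δ, hδ, hlt⟩ := exists_pos_prod_add_mul_lt_one _ ρ hlt
  have hpos : ∀ l < n, 0 < ρ l + δ := fun l hl =>
    add_pos_of_nonneg_of_pos ((hpath.step l hl).nonneg hE) hδ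
  -- `t` grows along the path by slightly more than its gains, so that only the closing edge could
  -- satisfy the inequality of `exists_le_mul_of_pairMatrix_mem`; but `δ` is too small for that.
  let t (l : Fin (n + 1)) : ℝ := ∏ k ∈ Finset.range l, (ρ k + δ)
  have ht : ∀ l, 0 < t l := fun l => Finset.prod_pos fun k hk =>
    hpos k ((Finset.mem_range.1 hk).trans_le l.is_le)
  obtain ⟨l, hl⟩ := exists_le_mul_of_pairMatrix_mem hE (σ := finRotate (n + 1))
    (v := fun l => v l) (ρ := Fin.snoc (fun l : Fin n => ρ l) τ) (t := t)
    (fun k l hkl => Fin.ext (hpath.injOn k.is_le l.is_le hkl))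
    (Fin.lastCases (by simpa using hτ.nonneg hE)
      fun l => by simpa using (hpath.step l l.is_lt).nonneg hE)
    (Fin.lastCases (by simpa using hτ.2) fun l => by simpa using (hpath.step l l.is_lt).2) ht
  induction l using Fin.lastCases with
  | last =>
    rw [finRotate_last, Fin.snoc_last, mul_comm] at hl
    exact hl.not_gt (by simpa [t] using hlt)
  | cast l =>
    have hsucc : t l.succ = t l.castSucc * (ρ l + δ) := Finset.prod_range_succ _ _
    have hincrease := mul_pos (ht l.castSucc) hδ
    rw [finRotate_apply, Fin.coeSucc_eq_succ, hsucc, Fin.snoc_castSucc] at hl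
    linarith

theorem exists_weightSystem_of_subset_stableMatrices
    (hE : (E : Set (Matrix N N ℝ)) ⊆ stableMatrices N) :
    ∃ ω : WeightSystem N, ∀ {i j p q}, i ≠ j → pairMatrix i j p q ∈ E → ω.Respects i j p q := by
  obtain ⟨ω, hω⟩ := exists_weightSystem_respects (R := InteractionRatio E)
    (fun _ _ _ h => h.nonneg hE) (fun _ _ _ h h0 => h.symm h0) fun _ _ hg =>
      hg.gain_eq_one (fun _ _ _ h => h.nonneg hE) (fun _ _ _ h h0 => h.symm h0)
        fun _ _ _ _ => one_le_prod_mul_of_isSimplePath hE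
  refine ⟨ω, fun {i j p q} hij hmem hp => ?_⟩
  obtain ⟨hlt, heq⟩ := hω (.of_pairMatrix_mem hij hp hmem) one_ne_zero
  refine ⟨fun hq => hlt (by simp [hq]), fun hq => ?_⟩
  obtain ⟨hrank, hweight⟩ := heq (mul_ne_zero (inv_ne_zero hp) hq)
  refine ⟨hrank, ?_⟩
  field_simp at hweight
  linarith

end Cycle

end WelfareSharing

theorem theorem1 {N : Type*} [Fintype N] [DecidableEq N]
    (𝕎 : Set (WelfareSharing.Welfare N))
    (f : 𝕎 → WelfareSharing.DistributionRule N) :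
    (∀ G ∈ WelfareSharing.gameClass 𝕎 f, ∃ a, G.IsNashEquilibrium a) ↔
      ∃ ω : WelfareSharing.WeightSystem N,
        ∀ W : 𝕎, f W = WelfareSharing.gwsv ω (f W).groundWelfare := by
  constructor
  · intro hNash
    obtain ⟨ω, hω⟩ := WelfareSharing.exists_weightSystem_of_subset_stableMatrices
      (WelfareSharing.span_range_matrix_subset_stableMatrices hNash)
    exact ⟨ω, fun W => WelfareSharing.eq_gwsv_groundWelfare fun _ _ hi _ hj hij =>
      hω hij (WelfareSharing.pairMatrix_moebius_mem_span W hij hi hj)⟩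
  · rintro ⟨ω, hω⟩ G hG
    choose hmem hrule using hG
    exact WelfareSharing.WelfareGame.exists_isNashEquilibrium_of_rule_eq_gwsv fun r =>
      (hrule r).trans (hω _)
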